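/- All toposes are taken over the category of (small) sets. A Grothendieck topos is a category equivalent to the category $\mathrm{Sh}(\mathcal C,J)$ of sheaves of sets on a small site. For a Grothendieck topos $\mathcal T$ let $\mathrm{Ab}(\mathcal T)$ be the category of abelian group objects of $\mathcal T$; it is an abelian category with enough injectives. For an object $B$ of $\mathcal T$ and $q \ge 0$ let $H^q(\mathcal T,B;-)$ be the $q$-th right derived functor of the left exact functor $\mathrm{Hom}_{\mathcal T}(B,-)\colon \mathrm{Ab}(\mathcal T)\to \mathrm{Ab}$. An object $F$ of $\mathrm{Ab}(\mathcal T)$ is called flabby if $H^q(\mathcal T,B;F)=0$ for all $q>0$ and all objects $B$ of $\mathcal T$. Let $f\colon \mathcal F\to\mathcal E$ be a geometric morphism between Grothendieck toposes, that is, a functor $f_*\colon\mathcal F\to\mathcal E$ together with a left adjoint $f^*\colon\mathcal E\to\mathcal F$ that preserves finite limits. Let $R^qf_*\colon \mathrm{Ab}(\mathcal F)\to\mathrm{Ab}(\mathcal E)$ denote the $q$-th right derived functor of the left exact functor $\mathrm{Ab}(\mathcal F)\to\mathrm{Ab}(\mathcal E)$ induced by $f_*$. If $F\in\mathrm{Ab}(\mathcal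 F)$ is flabby, then $$R^qf_*(F)=0\quad\text{for all } q>0,$$ that is, $F$ is $f_*$-acyclic. -/

import Mathlib

open CategoryTheory Limits MonoidalCategory CartesianMonoidalCategory Opposite

universe w u u₁ u₂ v

noncomputable section

namespace ToposCohomology

/-! ### Abelian group objects form a preadditive category -/

section CommGrp

open scoped MonObj

variable {C : Type u} [Category.{v} C] [CartesianMonoidalCategory C] [BraidedCategory C]

/-- Homomorphisms of abelian group objects form an abelian group: the sum of `f` and `g` is
their product in the group `Hom(A, B)` given by the group structure of `B`. -/
instance homAddCommGroup (A B : CommGrp C) : AddCommGroup (A ⟶ B) :=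
  Equiv.addCommGroup (β := Additive (A.toGrp ⟶ B.toGrp))
    (InducedCategory.homEquiv.trans Additive.ofMul)

theorem hom_add {A B : CommGrp C} (f g : A ⟶ B) :
    (f + g).hom.hom.hom = f.hom.hom.hom * g.hom.hom.hom := rfl

instance commGrpPreadditive : Preadditive (CommGrp C) where
  add_comp A B D f f' g := by
    apply CommGrp.hom_ext
    rw [hom_add]
    change (f.hom.hom.hom * f'.hom.hom.hom) ≫ g.hom.hom.hom = _
    rw [MonObj.mul_comp]
    rfl
  comp_add A B D f g g' := by
    apply CommGrp.hom_ext
    rw [hom_add]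
    change f.hom.hom.hom ≫ (g.hom.hom.hom * g'.hom.hom.hom) = _
    rw [MonObj.comp_mul]
    rfl

/-- The functor `Hom(B, -)` from abelian group objects to abelian groups. -/
def homFunctor (B : C) : CommGrp C ⥤ AddCommGrpCat.{v} where
  obj G := AddCommGrpCat.of (Additive (B ⟶ G.X))
  map {G H} φ := AddCommGrpCat.ofHom (MonoidHom.toAdditive
    { toFun := fun s => s ≫ φ.hom.hom.hom
      map_one' := MonObj.one_comp φ.hom.hom.hom
      map_mul' := fun s t => MonObj.mul_comp s t φ.hom.hom.hom })
  map_id G := by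
    refine AddCommGrpCat.hom_ext (AddMonoidHom.ext fun s => ?_)
    exact Category.comp_id (X := B) (Y := G.X) (Additive.toMul s)
  map_comp {G H K} φ ψ := by
    refine AddCommGrpCat.hom_ext (AddMonoidHom.ext fun s => ?_)
    exact (Category.assoc (Additive.toMul s) φ.hom.hom.hom ψ.hom.hom.hom).symm

instance homFunctor_additive (B : C) : (homFunctor B).Additive where
  map_add {G H φ ψ} := by
    refine AddCommGrpCat.hom_ext (AddMonoidHom.ext fun s => ?_)
    exact MonObj.comp_mul (Additive.toMul s) φ.hom.hom.hom ψ.hom.hom.hom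

instance mapCommGrp_additive {D : Type u₁} [Category.{w} D] [CartesianMonoidalCategory D]
    [BraidedCategory D] (F : C ⥤ D) [F.Braided] : F.mapCommGrp.Additive where
  map_add {G H φ ψ} := by
    apply CommGrp.hom_ext
    exact Functor.map_mul F φ.hom.hom.hom ψ.hom.hom.hom

end CommGrp

/-! ### Grothendieck toposes

A Grothendieck topos is a category equivalent to the category of sheaves of sets on a small site.
-/

/-- The category `E` is equivalent to `Sh(C, J)` for some small site `(C, J)`. -/
class IsGrothendieckTopos (E : Type u) [Category.{w} E] : Prop where
  exists_site : ∃ (C : Type w) (_ : SmallCategory C) (J : GrothendieckTopology C),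
    Nonempty (E ≌ Sheaf J (Type w))

/-! ### Abelian group objects of a Grothendieck topos are sheaves of abelian groups -/

section Comparison

open scoped MonObj

variable {E : Type u} [Category.{w} E]
variable {C : Type w} [SmallCategory C] {J : GrothendieckTopology C} (e : E ≌ Sheaf J (Type w))

/-- The object of the topos given by the sheaf associated to a representable presheaf. -/
def canonicalFunctor : C ⥤ E := yoneda ⋙ presheafToSheaf J (Type w) ⋙ e.inverse

/-- The adjunction between presheaves on the site and the topos. -/
def siteAdjunction : presheafToSheaf J (Type w) ⋙ e.inverse ⊣ e.functor ⋙ sheafToPresheaf J _ :=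
  (sheafificationAdjunction J (Type w)).comp e.symm.toAdjunction

/-- Maps out of the sheaf associated to `Hom(-, U)` are sections over `U`. -/
def sectionsEquiv (U : C) (Z : E) :
    ((canonicalFunctor e).obj U ⟶ Z) ≃ (e.functor.obj Z).obj.obj (op U) :=
  ((siteAdjunction e).homEquiv (yoneda.obj U) Z).trans yonedaEquiv

theorem sectionsEquiv_comp {U : C} {Y Z : E} (t : (canonicalFunctor e).obj U ⟶ Y) (g : Y ⟶ Z) :
    sectionsEquiv e U Z (t ≫ g) = (e.functor.map g).hom.app (op U) (sectionsEquiv e U Y t) :=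
  congrArg yonedaEquiv ((siteAdjunction e).homEquiv_naturality_right (X := yoneda.obj U) t g)

theorem sectionsEquiv_precomp {U V : C} {Z : E} (h : V ⟶ U) (t : (canonicalFunctor e).obj U ⟶ Z) :
    sectionsEquiv e V Z ((canonicalFunctor e).map h ≫ t) =
      (e.functor.obj Z).obj.map h.op (sectionsEquiv e U Z t) :=
  (congrArg yonedaEquiv
    ((siteAdjunction e).homEquiv_naturality_left (yoneda.map h) t)).trans
      (yonedaEquiv_naturality _ h).symm

theorem canonicalFunctor_hom_ext {Y Z : E} {g g' : Y ⟶ Z}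
    (h : ∀ (U : C) (t : (canonicalFunctor e).obj U ⟶ Y), t ≫ g = t ≫ g') : g = g' := by
  apply e.functor.map_injective
  apply Sheaf.hom_ext
  ext U x
  obtain ⟨t, rfl⟩ := (sectionsEquiv e U.unop Y).surjective x
  have := congrArg (sectionsEquiv e U.unop Z) (h U.unop t)
  rwa [sectionsEquiv_comp, sectionsEquiv_comp] at this

/-- The object of the topos underlying a sheaf of abelian groups. -/
def underlying : Sheaf J AddCommGrpCat.{w} ⥤ E :=
  sheafCompose J (forget AddCommGrpCat) ⋙ e.inverse

/-- The free abelian group functor of the topos. -/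
def freeAb : E ⥤ Sheaf J AddCommGrpCat.{w} :=
  e.functor ⋙ Sheaf.composeAndSheafify J AddCommGrpCat.free

/-- The free abelian group functor is left adjoint to the forgetful functor. -/
def freeAbAdj : freeAb e ⊣ underlying e :=
  e.toAdjunction.comp (Sheaf.adjunction J AddCommGrpCat.adj)

/-- Maps from `l(U)` to the underlying object of `P` are sections of `P` over `U`. -/
def underlyingSections (U : C) (P : Sheaf J AddCommGrpCat.{w}) :
    ((canonicalFunctor e).obj U ⟶ (underlying e).obj P) ≃ P.obj.obj (op U) :=
  (sectionsEquiv e U _).trans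
    (((sheafToPresheaf J (Type w) ⋙ (evaluation _ _).obj (op U)).mapIso
      (e.counitIso.app ((sheafCompose J (forget AddCommGrpCat)).obj P))).toEquiv)

theorem underlyingSections_comp {U : C} {P Q : Sheaf J AddCommGrpCat.{w}}
    (t : (canonicalFunctor e).obj U ⟶ (underlying e).obj P) (g : P ⟶ Q) :
    underlyingSections e U Q (t ≫ (underlying e).map g) =
      (g.hom.app (op U)).hom (underlyingSections e U P t) := by
  have h1 := sectionsEquiv_comp e t ((underlying e).map g)
  have h2 := congrArg (fun k => k.hom.app (op U) (sectionsEquiv e U _ t))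
    (e.counit.naturality ((sheafCompose J (forget AddCommGrpCat)).map g))
  exact (congrArg ((e.counit.app ((sheafCompose J (forget AddCommGrpCat)).obj Q)).hom.app (op U))
    h1).trans h2

theorem underlyingSections_precomp {U V : C} {P : Sheaf J AddCommGrpCat.{w}} (h : V ⟶ U)
    (t : (canonicalFunctor e).obj U ⟶ (underlying e).obj P) :
    underlyingSections e V P ((canonicalFunctor e).map h ≫ t) =
      (P.obj.map h.op).hom (underlyingSections e U P t) := by
  have h1 := sectionsEquiv_precomp e h t
  have h2 := congrArg (fun k => k (sectionsEquiv e U _ t))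
    ((e.counit.app ((sheafCompose J (forget AddCommGrpCat)).obj P)).hom.naturality h.op)
  exact (congrArg ((e.counit.app ((sheafCompose J (forget AddCommGrpCat)).obj P)).hom.app (op V))
    h1).trans h2

theorem underlyingSections_eq {U : C} {P : Sheaf J AddCommGrpCat.{w}}
    (t : (canonicalFunctor e).obj U ⟶ (underlying e).obj P) :
    underlyingSections e U P t = ((((freeAbAdj e).homEquiv _ P).symm t).hom.app (op U)).hom
      (underlyingSections e U _ ((freeAbAdj e).unit.app ((canonicalFunctor e).obj U))) := by
  refine Eq.trans ?_ (underlyingSections_comp e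
    ((freeAbAdj e).unit.app ((canonicalFunctor e).obj U)) (((freeAbAdj e).homEquiv _ P).symm t))
  exact congrArg (underlyingSections e U P) (((freeAbAdj e).homEquiv_unit _ _ _).symm.trans
    (((freeAbAdj e).homEquiv _ P).apply_symm_apply t)).symm

variable [CartesianMonoidalCategory E] [BraidedCategory E]

/-- The presheaf of abelian groups `U ↦ Hom(l(U), G)` of an abelian group object `G`. -/
def sectionsPresheaf (G : CommGrp E) : Cᵒᵖ ⥤ AddCommGrpCat.{w} where
  obj U := (homFunctor ((canonicalFunctor e).obj U.unop)).obj G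
  map {U V} h := AddCommGrpCat.ofHom (MonoidHom.toAdditive
    { toFun := fun s => (canonicalFunctor e).map h.unop ≫ s
      map_one' := MonObj.comp_one _
      map_mul' := fun s t => MonObj.comp_mul _ s t })
  map_id U := by
    refine AddCommGrpCat.hom_ext (AddMonoidHom.ext fun s => ?_)
    exact (congrArg (fun k => k ≫ (show (canonicalFunctor e).obj U.unop ⟶ G.X from s))
      ((canonicalFunctor e).map_id U.unop)).trans (Category.id_comp _)
  map_comp {U V W} h k := by
    refine AddCommGrpCat.hom_ext (AddMonoidHom.ext fun s => ?_)
    change (canonicalFunctor e).map (k.unop ≫ h.unop) ≫ Additive.toMul s =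
      (canonicalFunctor e).map k.unop ≫ (canonicalFunctor e).map h.unop ≫ Additive.toMul s
    simp

/-- The underlying presheaf of sets of `U ↦ Hom(l(U), G)` is the sheaf corresponding to `G`. -/
def sectionsPresheafForget (G : CommGrp E) :
    sectionsPresheaf e G ⋙ forget AddCommGrpCat ≅ (e.functor.obj G.X).obj :=
  NatIso.ofComponents (fun U => (sectionsEquiv e U.unop G.X).toIso) (fun {U V} h => by
    ext s
    exact sectionsEquiv_precomp e h.unop _)

/-- The functor sending an abelian group object to the corresponding sheaf of abelian groups. -/
def toSheafAb : CommGrp E ⥤ Sheaf J AddCommGrpCat.{w} where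
  obj G := ⟨sectionsPresheaf e G, by
    rw [Presheaf.isSheaf_iff_isSheaf_forget J _ (forget AddCommGrpCat)]
    exact (Presheaf.isSheaf_of_iso_iff (sectionsPresheafForget e G)).2
      (e.functor.obj G.X).property⟩
  map {G H} φ := ⟨{
    app := fun U => (homFunctor ((canonicalFunctor e).obj U.unop)).map φ
    naturality := fun U V h => by
      refine AddCommGrpCat.hom_ext (AddMonoidHom.ext fun s => ?_)
      exact Category.assoc _ (Additive.toMul s) φ.hom.hom.hom }⟩
  map_id G := by
    apply Sheaf.hom_ext
    ext U : 2
    exact (homFunctor ((canonicalFunctor e).obj U.unop)).map_id G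
  map_comp φ ψ := by
    apply Sheaf.hom_ext
    ext U : 2
    exact (homFunctor ((canonicalFunctor e).obj U.unop)).map_comp φ ψ

instance toSheafAb_faithful : (toSheafAb e).Faithful where
  map_injective {G H φ ψ} h := by
    apply CommGrp.hom_ext
    refine canonicalFunctor_hom_ext e fun U t => ?_
    have := congrArg (fun k => k.hom.app (op U)) h
    exact congrArg (fun k => k.hom (Additive.ofMul t)) this

/-- A map of underlying objects that is multiplicative on sections is a homomorphism. -/
theorem exists_hom_of_sections {G H : CommGrp E} (g : G.X ⟶ H.X)
    (hg : ∀ (U : C) (s t : (canonicalFunctor e).obj U ⟶ G.X),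
      (s * t) ≫ g = (s ≫ g) * (t ≫ g)) :
    ∃ φ : G ⟶ H, φ.hom.hom.hom = g := by
  have hmul : MonObj.mul (X := G.X) ≫ g = (g ⊗ₘ g) ≫ MonObj.mul (X := H.X) := by
    refine canonicalFunctor_hom_ext e fun U t => ?_
    have h := hg U (t ≫ fst _ _) (t ≫ snd _ _)
    rw [Hom.mul_def, Hom.mul_def] at h
    have ht : lift (t ≫ fst G.X G.X) (t ≫ snd G.X G.X) = t := by
      rw [← comp_lift, lift_fst_snd, Category.comp_id]
    have ht' : lift ((t ≫ fst G.X G.X) ≫ g) ((t ≫ snd G.X G.X) ≫ g) = t ≫ (g ⊗ₘ g) := by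
      rw [← lift_map, ht]
    rw [ht, ht'] at h
    simpa using h
  have hone : MonObj.one (X := G.X) ≫ g = MonObj.one (X := H.X) := by
    have h := congrArg (fun k => lift (1 : 𝟙_ E ⟶ G.X) 1 ≫ k) hmul
    simp only [lift_map_assoc] at h
    rw [← Category.assoc, ← Hom.mul_def, ← Hom.mul_def, mul_one] at h
    rw [MonObj.one_eq_one, MonObj.one_eq_one]
    exact left_eq_mul.1 h
  exact ⟨InducedCategory.homMk (Grp.homMk'' g hone hmul), rfl⟩

instance toSheafAb_full : (toSheafAb e).Full where
  map_surjective {G H} ψ := by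
    let ψ' : (e.functor.obj G.X).obj ⟶ (e.functor.obj H.X).obj :=
      (sectionsPresheafForget e G).inv ≫ Functor.whiskerRight ψ.hom (forget AddCommGrpCat) ≫
        (sectionsPresheafForget e H).hom
    let g : G.X ⟶ H.X := e.functor.preimage ⟨ψ'⟩
    have key : ∀ (U : C) (t : (canonicalFunctor e).obj U ⟶ G.X),
        t ≫ g = Additive.toMul ((ψ.hom.app (op U)).hom (Additive.ofMul t)) := by
      intro U t
      apply (sectionsEquiv e U H.X).injective
      rw [sectionsEquiv_comp, Functor.map_preimage]
      change (sectionsEquiv e U H.X) ((ψ.hom.app (op U)).hom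
        ((sectionsEquiv e U G.X).symm (sectionsEquiv e U G.X t))) = _
      rw [Equiv.symm_apply_apply]
      rfl
    obtain ⟨φ, hφ⟩ := exists_hom_of_sections e g (fun U s t => by
      rw [key, key, key]
      exact congrArg Additive.toMul ((ψ.hom.app (op U)).hom.map_add (Additive.ofMul s)
        (Additive.ofMul t)))
    refine ⟨φ, ?_⟩
    apply Sheaf.hom_ext
    ext U : 2
    refine AddCommGrpCat.hom_ext (AddMonoidHom.ext fun s => ?_)
    change Additive.ofMul (Additive.toMul s ≫ φ.hom.hom.hom) = _
    rw [hφ]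
    exact key U.unop (Additive.toMul s)

/-- The presheaf of groups on the topos represented by a sheaf of abelian groups. -/
def homPresheaf (P : Sheaf J AddCommGrpCat.{w}) : Eᵒᵖ ⥤ CommGrpCat.{w} :=
  (freeAb e).op ⋙ preadditiveYoneda.obj P ⋙ AddCommGrpCat.toCommGrp

/-- The underlying object represents this presheaf. -/
def homPresheafRepresentable (P : Sheaf J AddCommGrpCat.{w}) :
    (homPresheaf e P ⋙ forget CommGrpCat).RepresentableBy ((underlying e).obj P) where
  homEquiv := ((freeAbAdj e).homEquiv _ P).symm
  homEquiv_comp f g := (freeAbAdj e).homEquiv_naturality_left_symm f g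

instance underlyingCommGrpObj (P : Sheaf J AddCommGrpCat.{w}) :
    CommGrpObj ((underlying e).obj P) :=
  CommGrpObj.ofRepresentableBy _ (homPresheaf e P) (homPresheafRepresentable e P)

theorem underlying_mul (P : Sheaf J AddCommGrpCat.{w}) {Y : E} (s t : Y ⟶ (underlying e).obj P) :
    ((freeAbAdj e).homEquiv Y P).symm (s * t) =
      ((freeAbAdj e).homEquiv Y P).symm s + ((freeAbAdj e).homEquiv Y P).symm t := by
  have hμ : MonObj.mul (X := (underlying e).obj P) = (freeAbAdj e).homEquiv _ P
      (((freeAbAdj e).homEquiv _ P).symm (fst _ _) +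
        ((freeAbAdj e).homEquiv _ P).symm (snd _ _)) := rfl
  rw [Hom.mul_def, hμ, Adjunction.homEquiv_naturality_left_symm, Equiv.symm_apply_apply,
    Preadditive.comp_add, ← Adjunction.homEquiv_naturality_left_symm,
    ← Adjunction.homEquiv_naturality_left_symm, lift_fst, lift_snd]

theorem underlyingSections_mul {U : C} {P : Sheaf J AddCommGrpCat.{w}}
    (s t : (canonicalFunctor e).obj U ⟶ (underlying e).obj P) :
    underlyingSections e U P (s * t) = underlyingSections e U P s + underlyingSections e U P t := by
  rw [underlyingSections_eq, underlyingSections_eq e s, underlyingSections_eq e t, underlying_mul]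
  rfl

instance toSheafAb_essSurj : (toSheafAb e).EssSurj where
  mem_essImage P := by
    let i : ((toSheafAb e).obj ⟨(underlying e).obj P⟩).obj ≅ P.obj :=
      NatIso.ofComponents (fun U => AddEquiv.toAddCommGrpIso
        { toEquiv := Additive.toMul.trans (underlyingSections e U.unop P)
          map_add' := fun s t => underlyingSections_mul e (Additive.toMul s) (Additive.toMul t) })
        (fun {U V} h => by
          refine AddCommGrpCat.hom_ext (AddMonoidHom.ext fun s => ?_)
          exact underlyingSections_precomp e h.unop (Additive.toMul s))
    exact ⟨⟨(underlying e).obj P⟩, ⟨(fullyFaithfulSheafToPresheaf J _).preimageIso i⟩⟩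

instance toSheafAb_isEquivalence : (toSheafAb e).IsEquivalence where

end Comparison

/-! ### `Ab(E)` is an abelian category with enough injectives -/

section Abelian

variable {E : Type u} [Category.{w} E] [CartesianMonoidalCategory E] [BraidedCategory E]

theorem commGrp_exists_equivalence (E : Type u) [Category.{w} E] [CartesianMonoidalCategory E]
    [BraidedCategory E] [IsGrothendieckTopos E] :
    ∃ (C : Type w) (_ : SmallCategory C) (J : GrothendieckTopology C)
      (Φ : CommGrp E ⥤ Sheaf J AddCommGrpCat.{w}), Φ.IsEquivalence := by
  obtain ⟨C, hC, J, ⟨e⟩⟩ := IsGrothendieckTopos.exists_site (E := E)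
  exact ⟨C, hC, J, toSheafAb e, inferInstance⟩

instance commGrp_hasFiniteProducts [IsGrothendieckTopos E] : HasFiniteProducts (CommGrp E) := by
  obtain ⟨C, _, J, Φ, _⟩ := commGrp_exists_equivalence E
  exact ⟨fun n => Adjunction.hasLimitsOfShape_of_equivalence Φ⟩

theorem commGrp_abelian_aux [IsGrothendieckTopos E] :
    IsNormalMonoCategory (CommGrp E) ∧ IsNormalEpiCategory (CommGrp E) ∧
      HasKernels (CommGrp E) ∧ HasCokernels (CommGrp E) := by
  obtain ⟨C, _, J, Φ, _⟩ := commGrp_exists_equivalence E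
  let A : Abelian (CommGrp E) := abelianOfEquivalence Φ
  exact ⟨A.toIsNormalMonoCategory, A.toIsNormalEpiCategory, A.has_kernels, A.has_cokernels⟩

instance commGrpAbelian [IsGrothendieckTopos E] : Abelian (CommGrp E) where
  toPreadditive := commGrpPreadditive
  toIsNormalMonoCategory := commGrp_abelian_aux.1
  toIsNormalEpiCategory := commGrp_abelian_aux.2.1
  has_kernels := commGrp_abelian_aux.2.2.1
  has_cokernels := commGrp_abelian_aux.2.2.2

instance commGrp_enoughInjectives [IsGrothendieckTopos E] : EnoughInjectives (CommGrp E) := by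
  obtain ⟨C, _, J, Φ, _⟩ := commGrp_exists_equivalence E
  exact EnoughInjectives.of_equivalence Φ

end Abelian

/-! ### Cohomology, flabby objects and higher direct images -/

section Cohomology

variable {E : Type u} [Category.{w} E] [CartesianMonoidalCategory E] [BraidedCategory E]
  [IsGrothendieckTopos E]

/-- `H^q(E, B; F)`: the right derived functors of `Hom(B, -) : Ab(E) ⥤ Ab`. -/
def cohomology (q : ℕ) (B : E) : CommGrp E ⥤ AddCommGrpCat.{w} := (homFunctor B).rightDerived q

/-- An abelian group object `F` is flabby if `H^q(E, B; F) = 0` for all `q > 0` and all `B`. -/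
def IsFlabby (F : CommGrp E) : Prop :=
  ∀ q : ℕ, 0 < q → ∀ B : E, IsZero ((cohomology q B).obj F)

end Cohomology

/-- A geometric morphism `F → E`: a direct image functor with a left exact left adjoint. -/
structure GeometricMorphism (F : Type u₁) [Category.{w} F] (E : Type u₂) [Category.{w} E] where
  /-- the direct image functor -/
  directImage : F ⥤ E
  /-- the inverse image functor -/
  inverseImage : E ⥤ F
  /-- the inverse image is left adjoint to the direct image -/
  adj : inverseImage ⊣ directImage
  /-- the inverse image is left exact -/
  preservesFiniteLimits : PreservesFiniteLimits inverseImage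

namespace GeometricMorphism

variable {F : Type u₁} [Category.{w} F] [CartesianMonoidalCategory F] [BraidedCategory F]
variable {E : Type u₂} [Category.{w} E] [CartesianMonoidalCategory E] [BraidedCategory E]

/-- The direct image preserves finite products, hence is (uniquely) a cartesian functor. -/
instance directImageBraided (f : GeometricMorphism F E) : f.directImage.Braided :=
  haveI : PreservesLimitsOfSize.{0, 0} f.directImage := f.adj.rightAdjoint_preservesLimits
  .ofChosenFiniteProducts _

/-- The direct image on abelian group objects, `f_* : Ab(F) ⥤ Ab(E)`. -/
def directImageAb (f : GeometricMorphism F E) : CommGrp F ⥤ CommGrp E :=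
  f.directImage.mapCommGrp

instance directImageAb_additive (f : GeometricMorphism F E) : f.directImageAb.Additive :=
  mapCommGrp_additive f.directImage

/-- The higher direct images `R^q f_* : Ab(F) ⥤ Ab(E)`. -/
def higherDirectImage [IsGrothendieckTopos F] [IsGrothendieckTopos E]
    (f : GeometricMorphism F E) (q : ℕ) : CommGrp F ⥤ CommGrp E :=
  f.directImageAb.rightDerived q

end GeometricMorphism

end ToposCohomology

end

/-! Take an injective resolution `I` of `F`. The object R^q f_* F is the q-th cohomology of the
complex f_* I, so the claim is that this complex is exact in degree q. For each object B of 𝓔,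
adjunction identifies the complex of sections Hom(B, f_* I) with Hom(f^* B, I), whose q-th
cohomology is H^q(𝓕, f^* B; F). Flabbiness makes it vanish for q > 0 (`homFunctorIso`).

It remains to pass from exactness on sections over every B to exactness in Ab(𝓔), which is
`exact_of_exact_homFunctor`. Since all objects of the topos are available as tests, no local lifting
or sheafification is needed: testing on the object of cycles lifts the universal cycle at once. -/

namespace ToposCohomology

open CategoryTheory Limits MonoidalCategory CartesianMonoidalCategory Opposite

/-! ### Exactness in Ab(E) tested on sections -/

section Exactness

variable {E : Type u} [Category.{w} E] [CartesianMonoidalCategory E] [BraidedCategory E]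

/-- A monomorphism of abelian group objects of a topos is a monomorphism of underlying objects. -/
theorem mono_hom_of_mono [IsGrothendieckTopos E] {G H : CommGrp E} (φ : G ⟶ H) [Mono φ] :
    Mono φ.hom.hom.hom := by
  obtain ⟨C, _, J, ⟨e⟩⟩ := IsGrothendieckTopos.exists_site (E := E)
  refine ⟨fun {Z} a b hab => canonicalFunctor_hom_ext e fun U t => ?_⟩
  -- The equivalence with sheaves and the inclusion into presheaves both preserve monomorphisms, and
  -- a monomorphism of presheaves is one over each `U`.
  have : Mono (((sheafToPresheaf J AddCommGrpCat).map ((toSheafAb e).map φ)).app (op U)) :=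
    inferInstance
  have hinj := (AddCommGrpCat.mono_iff_injective _).1 this
  have h : (t ≫ a) ≫ φ.hom.hom.hom = (t ≫ b) ≫ φ.hom.hom.hom := by
    rw [Category.assoc, Category.assoc, hab]
  exact Additive.ofMul.injective (@hinj (Additive.ofMul (t ≫ a)) (Additive.ofMul (t ≫ b))
    (congrArg Additive.ofMul h))

/-- A homomorphism of abelian group objects that has a section on underlying objects is an
epimorphism. -/
theorem epi_of_section {G H : CommGrp E} (φ : G ⟶ H) (s : H.X ⟶ G.X)
    (hs : s ≫ φ.hom.hom.hom = 𝟙 H.X) : Epi φ := by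
  constructor
  intro K a b hab
  -- Since `s` need not be a homomorphism, the cancellation takes place in `E`, where homomorphisms
  -- are determined by their underlying maps.
  apply CommGrp.hom_ext
  have h : φ.hom.hom.hom ≫ a.hom.hom.hom = φ.hom.hom.hom ≫ b.hom.hom.hom :=
    congrArg (fun k => k.hom.hom.hom) hab
  have := congrArg (fun k => s ≫ k) h
  simpa only [← Category.assoc, hs, Category.id_comp] using this

/-- A short complex of abelian group objects is exact if it is exact on sections over every
object of the topos. -/
theorem exact_of_exact_homFunctor [IsGrothendieckTopos E] (S : ShortComplex (CommGrp E))
    (hS : ∀ B : E, (S.map (homFunctor B)).Exact) : S.Exact := by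
  rw [S.exact_iff_epi_toCycles]
  -- The universal test object: over the cycles, the inclusion `S.iCycles` is itself a section of
  -- the middle term killed by `S.g`.
  have h := hS S.cycles.X
  rw [ShortComplex.ab_exact_iff] at h
  obtain ⟨s, hs⟩ := h (Additive.ofMul S.iCycles.hom.hom.hom) (by
    have h0 : ((homFunctor S.cycles.X).map (S.iCycles ≫ S.g)).hom
        (Additive.ofMul (𝟙 S.cycles.X)) = 0 := by
      rw [S.iCycles_g, Functor.map_zero]
      rfl
    rw [Functor.map_comp] at h0
    refine Eq.trans ?_ h0
    exact congrArg (fun k => ((homFunctor S.cycles.X).map S.g).hom (Additive.ofMul k))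
      (Category.id_comp S.iCycles.hom.hom.hom).symm)
  have hs' : Additive.toMul s ≫ S.f.hom.hom.hom = S.iCycles.hom.hom.hom :=
    congrArg Additive.toMul hs
  -- The lift `s` of the inclusion is only a map of objects of `E`, not a homomorphism. It splits
  -- `S.toCycles` because the inclusion of cycles stays monic in `E`.
  refine epi_of_section S.toCycles (Additive.toMul s) ?_
  have := mono_hom_of_mono S.iCycles
  rw [← cancel_mono S.iCycles.hom.hom.hom, Category.id_comp, Category.assoc]
  have hf : S.toCycles.hom.hom.hom ≫ S.iCycles.hom.hom.hom = S.f.hom.hom.hom :=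
    congrArg (fun k => k.hom.hom.hom) S.toCycles_i
  rw [hf]
  exact hs'

end Exactness

/-! ### Adjunction on sections, and the main theorem -/

namespace GeometricMorphism

variable {F : Type u₁} [Category.{w} F] [CartesianMonoidalCategory F] [BraidedCategory F]
variable {E : Type u₂} [Category.{w} E] [CartesianMonoidalCategory E] [BraidedCategory E]

open scoped MonObj in
/-- Sections of `f_* G` over `B` are sections of `G` over `f^* B`. -/
noncomputable def homFunctorIso (f : GeometricMorphism F E) (B : E) :
    homFunctor (f.inverseImage.obj B) ≅ f.directImageAb ⋙ homFunctor B :=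
  NatIso.ofComponents (fun G => AddEquiv.toAddCommGrpIso
    { toEquiv := Additive.toMul.trans ((f.adj.homEquiv B G.X).trans Additive.ofMul)
      map_add' := fun s t => by
        let s' : f.inverseImage.obj B ⟶ G.X := Additive.toMul s
        let t' : f.inverseImage.obj B ⟶ G.X := Additive.toMul t
        let m : (f.inverseImage.obj B ⟶ G.X) → (B ⟶ (f.directImageAb.obj G).X) :=
          f.adj.homEquiv B G.X
        change m (s' * t') = m s' * m t'
        dsimp only [m]
        simp only [Adjunction.homEquiv_unit]
        -- The transpose is `f_*` of the map precomposed with the unit. The group law of `f_* G` is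
        -- the image of that of `G`, so applying `f_*` is multiplicative, and so is precomposition.
        refine (congrArg _ (Functor.map_mul f.directImage s' t')).trans ?_
        exact MonObj.comp_mul (M := (f.directImageAb.obj G).X) _ _ _ })
    (fun {G H} φ => by
      refine AddCommGrpCat.hom_ext (AddMonoidHom.ext fun s => ?_)
      exact f.adj.homEquiv_naturality_right (Additive.toMul s) φ.hom.hom.hom)

end GeometricMorphism

end ToposCohomology

theorem mainTheorem10
    {𝓕 : Type u₁} [Category.{w} 𝓕] [CartesianMonoidalCategory 𝓕] [BraidedCategory 𝓕]
    [ToposCohomology.IsGrothendieckTopos 𝓕]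
    {𝓔 : Type u₂} [Category.{w} 𝓔] [CartesianMonoidalCategory 𝓔] [BraidedCategory 𝓔]
    [ToposCohomology.IsGrothendieckTopos 𝓔]
    (f : ToposCohomology.GeometricMorphism 𝓕 𝓔)
    (F : CommGrp 𝓕) (hF : ToposCohomology.IsFlabby F) (q : ℕ) (hq : 0 < q) :
    IsZero ((f.higherDirectImage q).obj F) := by
  let I := injectiveResolution F
  refine IsZero.of_iso ?_ (InjectiveResolution.isoRightDerivedObj I f.directImageAb q)
  refine (HomologicalComplex.exactAt_iff_isZero_homology _ q).1 ?_
  refine ToposCohomology.exact_of_exact_homFunctor _ fun B => ?_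
  -- Flabbiness is applied to `f^* B`: the same resolution `I` computes both this cohomology and the
  -- higher direct images.
  have hB : ((((ToposCohomology.homFunctor (f.inverseImage.obj B)).mapHomologicalComplex _).obj
      I.cocomplex).sc q).Exact :=
    (HomologicalComplex.exactAt_iff_isZero_homology _ q).2
      ((hF q hq (f.inverseImage.obj B)).of_iso
        (InjectiveResolution.isoRightDerivedObj I _ q).symm)
  exact (ShortComplex.exact_iff_of_iso
    ((I.cocomplex.sc q).mapNatIso (f.homFunctorIso B))).1 hB
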